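/- Let $\tau_{\mathrm{ord}}=\langle <;\mathsf{min},\mathsf{max}\rangle$ be the vocabulary with one binary relation symbol $<$ and two constant symbols. For $m\ge 1$ let $L_m$, the linear order of length $m$, be the $\tau_{\mathrm{ord}}$-structure with $m+1$ elements (unique up to isomorphism) in which $<$ is a strict linear order and $\mathsf{min}$, $\mathsf{max}$ are its first and last elements. For $\ell\ge 1$ let $L_{\le \ell}=\{L_m : 1\le m\le \ell\}$ and $L_{>\ell}=\{L_m : m>\ell\}$. A first-order sentence (with equality) over $\tau_{\mathrm{ord}}$ separates $L_{\le\ell}$ from $L_{>\ell}$ if it is true in every structure of $L_{\le \ell}$ and false in every structure of $L_{>\ell}$. Let $r(\ell)$ be the minimal quantifier rank (maximal depth of nesting of quantifiers), and $q(\ell)$ the minimal number of quantifiers (counting all occurrences), of a sentence separating $L_{\le\ell}$ from $L_{>\ell}$. Theorem. For every integer $\ell\ge 1$, a separating sentence exists (so that $r(\ell)$ and $q(\ell)$ are well defined), and $$ r(\ell)\le q(\ell)\le r(\ell)+1 .$$ -/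

import Mathlib

open FirstOrder

/-- The constant symbols `min` and `max` of the vocabulary of orders. -/
inductive OrdFunctions : ℕ → Type
  | min : OrdFunctions 0
  | max : OrdFunctions 0

/-- The binary relation symbol `<` of the vocabulary of orders. -/
inductive OrdRelations : ℕ → Type
  | lt : OrdRelations 2

/-- The vocabulary of orders `⟨< ; min, max⟩`. -/
def ordVocabulary : FirstOrder.Language := ⟨OrdFunctions, OrdRelations⟩

/-- The universe `{0, …, m}` with its usual order, `min` and `max` being its first and last
elements. -/
instance ordStructure (m : ℕ) : ordVocabulary.Structure (Fin (m + 1)) where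
  funMap := fun {_} f _ =>
    match f with
    | OrdFunctions.min => 0
    | OrdFunctions.max => Fin.last m
  RelMap := fun {_} R =>
    match R with
    | OrdRelations.lt => fun x => x 0 < x 1

/-- The linear order `L_m` of length `m`: it has `m + 1` elements. -/
def linOrd (m : ℕ) : CategoryTheory.Bundled.{0} ordVocabulary.Structure :=
  ⟨Fin (m + 1), ordStructure m⟩

/-- The set of linear orders of (positive) length at most `l`. -/
def linOrdLE (l : ℕ) : Set (CategoryTheory.Bundled.{0} ordVocabulary.Structure) :=
  {M | ∃ m : ℕ, 1 ≤ m ∧ m ≤ l ∧ M = linOrd m}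

/-- The set of linear orders of length greater than `l`. -/
def linOrdGT (l : ℕ) : Set (CategoryTheory.Bundled.{0} ordVocabulary.Structure) :=
  {M | ∃ m : ℕ, l < m ∧ M = linOrd m}

/-- The sentence `φ` separates `𝒜` from `ℬ`: it is true in every structure of `𝒜` and false in
every structure of `ℬ`. -/
def Separates {L : FirstOrder.Language} (φ : L.Sentence)
    (𝒜 ℬ : Set (CategoryTheory.Bundled.{0} L.Structure)) : Prop :=
  (∀ M ∈ 𝒜, letI := M.str; M.α ⊨ φ) ∧ (∀ M ∈ ℬ, letI := M.str; ¬ M.α ⊨ φ)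

/-- The number of (occurrences of) quantifiers in a formula. An existential quantifier `∃` is
`¬ ∀ ¬` and so counts as one. -/
def quantifierNumber {L : FirstOrder.Language} {α : Type} :
    {n : ℕ} → L.BoundedFormula α n → ℕ
  | _, .falsum => 0
  | _, .equal _ _ => 0
  | _, .rel _ _ => 0
  | _, .imp φ ψ => quantifierNumber φ + quantifierNumber ψ
  | _, .all φ => quantifierNumber φ + 1

/-- The quantifier rank of a formula: the maximal depth of nesting of its quantifiers. -/
def quantifierRank {L : FirstOrder.Language} {α : Type} :
    {n : ℕ} → L.BoundedFormula α n → ℕ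
  | _, .falsum => 0
  | _, .equal _ _ => 0
  | _, .rel _ _ => 0
  | _, .imp φ ψ => max (quantifierRank φ) (quantifierRank ψ)
  | _, .all φ => quantifierRank φ + 1

/-- The minimal quantifier rank of a sentence separating the linear orders of length at most `l`
from those of length greater than `l`. -/
noncomputable def minRank (l : ℕ) : ℕ :=
  sInf {k | ∃ φ : ordVocabulary.Sentence,
    Separates φ (linOrdLE l) (linOrdGT l) ∧ quantifierRank φ = k}

/-- The minimal number of quantifiers of a sentence separating the linear orders of length at most
`l` from those of length greater than `l`. -/
noncomputable def minNumber (l : ℕ) : ℕ :=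
  sInf {k | ∃ φ : ordVocabulary.Sentence,
    Separates φ (linOrdLE l) (linOrdGT l) ∧ quantifierNumber φ = k}

open FirstOrder Language

namespace LinearOrderSeparation

/-! ### Quantifier rank: the Ehrenfeucht-Fraïssé argument -/

/-! Rank never exceeds number, so `r ≤ q` is immediate. For `q ≤ r + 1`, both are compared with
powers of two. A separating sentence of rank `k` forces `l < 2 ^ k` (`lt_two_pow_quantifierRank`):
otherwise the Ehrenfeucht-Fraïssé game cannot tell `L_l` from `L_{l+1}`. Conversely, `l < 2 ^ k`
yields a separating prenex sentence with `k + 1` quantifiers (`exists_sentence_of_lt_two_pow`).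

Plain halving of a distance creates two subproblems, which would double the quantifiers. Alternation
avoids this: a conjunction of two distance bounds is a `∀` over disjunctions, and a disjunction is
an `∃` over conjunctions. One variable serves both bounds, because its position selects the interval
it tests, and `PrenexDefinable.ite` merges the cases under a common prefix. -/

theorem quantifierRank_le_quantifierNumber {L : FirstOrder.Language} {α : Type} {n : ℕ}
    (φ : L.BoundedFormula α n) : quantifierRank φ ≤ quantifierNumber φ := by
  induction φ with
  | falsum => simp [quantifierRank]
  | equal => simp [quantifierRank]
  | rel => simp [quantifierRank]
  | imp φ ψ h₁ h₂ => simp only [quantifierRank, quantifierNumber]; omega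
  | all φ h => simp only [quantifierRank, quantifierNumber]; omega

/-- The set `S` of pairs preserves all distances, truncated at `K`. -/
def PreservesDist (K : ℕ) (S : Finset (ℕ × ℕ)) : Prop :=
  ∀ a ∈ S, ∀ b ∈ S, min (a.1 - b.1) K = min (a.2 - b.2) K

theorem PreservesDist.mono {K K' : ℕ} {S : Finset (ℕ × ℕ)} (h : PreservesDist K S) (hK : K' ≤ K) :
    PreservesDist K' S := by
  intro a ha b hb
  have := h a ha b hb
  omega

theorem PreservesDist.swap {K : ℕ} {S : Finset (ℕ × ℕ)} (h : PreservesDist K S) :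
    PreservesDist K (S.image Prod.swap) := by
  intro a ha b hb
  obtain ⟨a', ha', rfl⟩ := Finset.mem_image.1 ha
  obtain ⟨b', hb', rfl⟩ := Finset.mem_image.1 hb
  exact (h a' ha' b' hb').symm

/-- As subtraction stops at zero, the two differences together also record the order of the points.
The right side is the case split handed to `omega`. -/
theorem min_tsub_eq_iff {K a b a' b' : ℕ} (hK : 1 ≤ K) :
    (min (a - b) K = min (a' - b') K ∧ min (b - a) K = min (b' - a') K) ↔
      (b ≤ a ∧ b' ≤ a' ∧ (a + b' = a' + b ∨ b + K ≤ a ∧ b' + K ≤ a')) ∨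
      (a ≤ b ∧ a' ≤ b' ∧ (a + b' = a' + b ∨ a + K ≤ b ∧ a' + K ≤ b')) := by
  omega

/-- One round of the game: answering a move costs half of the truncation bound, since a gap of at
least `2 * K` has room for a point at distance at least `K` from both ends. -/
theorem PreservesDist.exists_insert {K m m' : ℕ} (hK : 1 ≤ K) {S : Finset (ℕ × ℕ)}
    (h : PreservesDist (2 * K) S) (h0 : (0, 0) ∈ S) (hm : (m, m') ∈ S) {x : ℕ} (hx : x ≤ m) :
    ∃ y ≤ m', PreservesDist K (insert (x, y) S) := by
  -- `f a` is the lower bound that the pair `a` puts on the answer; the answer is the largest of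
  -- these bounds.
  let f : ℕ × ℕ → ℕ := fun a =>
    if a.1 ≤ x then a.2 + min (x - a.1) K else if a.1 - x < K then a.2 - (a.1 - x) else 0
  obtain ⟨i, hi, hmax⟩ := S.exists_max_image f ⟨_, h0⟩
  have key : ∀ a ∈ S, min (a.1 - x) K = min (a.2 - f i) K ∧
      min (x - a.1) K = min (f i - a.2) K := by
    intro a ha
    have spec : ∀ a, (a.1 ≤ x ∧ x ≤ a.1 + K ∧ f a + a.1 = a.2 + x) ∨
        (a.1 + K < x ∧ f a = a.2 + K) ∨
        (x < a.1 ∧ a.1 < x + K ∧ (f a + a.1 = a.2 + x ∨ a.2 + x < a.1)) ∨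
        (x + K ≤ a.1 ∧ f a = 0) := by
      intro a
      simp only [f]
      split_ifs <;> omega
    have h₀ := hmax _ h0
    have h₁ := hmax a ha
    have s₀ := spec (0, 0)
    have sa := spec a
    have si := spec i
    have h₂ := (min_tsub_eq_iff (by omega)).1 ⟨h a ha i hi, h i hi a ha⟩
    have ha₀ : a.1 = a.2 ∨ 2 * K ≤ a.1 ∧ 2 * K ≤ a.2 := by
      have := h a ha _ h0
      simp only at this
      omega
    have hi₀ : i.1 = i.2 ∨ 2 * K ≤ i.1 ∧ 2 * K ≤ i.2 := by
      have := h i hi _ h0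
      simp only at this
      omega
    rw [min_tsub_eq_iff hK]
    simp only at s₀
    generalize f a = u at *
    generalize f i = y at *
    generalize f (0, 0) = z at *
    clear * - hK h₀ h₁ s₀ sa si h₂ ha₀ hi₀
    rcases h₂ with ⟨_, _, _ | _⟩ | ⟨_, _, _ | _⟩ <;> rcases si with _ | _ | _ | _ <;>
      rcases sa with _ | _ | _ | _ <;> omega
  refine ⟨f i, ?_, ?_⟩
  · have := key _ hm
    simp only at this
    omega
  · intro a ha b hb
    rcases Finset.mem_insert.1 ha with rfl | ha <;> rcases Finset.mem_insert.1 hb with rfl | hb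
    · simp
    · exact (key b hb).2
    · exact (key a ha).1
    · exact h.mono (by omega) a ha b hb

theorem realize_term_mem {m m' n : ℕ} {v : Fin n → Fin (m + 1)} {w : Fin n → Fin (m' + 1)}
    {S : Finset (ℕ × ℕ)} (h0 : (0, 0) ∈ S) (hm : (m, m') ∈ S)
    (hv : ∀ i, ((v i : ℕ), (w i : ℕ)) ∈ S) (t : ordVocabulary.Term (Empty ⊕ Fin n)) :
    (((t.realize (Sum.elim default v) : Fin (m + 1)) : ℕ),
      ((t.realize (Sum.elim default w) : Fin (m' + 1)) : ℕ)) ∈ S := by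
  cases t with
  | var i =>
    rcases i with i | i
    · exact i.elim
    · exact hv i
  | func f ts =>
    cases f with
    | min => exact h0
    | max => exact hm

/-- Each quantifier halves the bound `2 ^ k`. At the end it is still at least `1`, enough to
preserve `=` and `<`. -/
theorem realize_iff_of_preservesDist {n : ℕ} (φ : ordVocabulary.BoundedFormula Empty n) :
    ∀ {k m m' : ℕ} {v : Fin n → Fin (m + 1)} {w : Fin n → Fin (m' + 1)} {S : Finset (ℕ × ℕ)},
      quantifierRank φ ≤ k → PreservesDist (2 ^ k) S → (0, 0) ∈ S → (m, m') ∈ S →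
      (∀ i, ((v i : ℕ), (w i : ℕ)) ∈ S) → (φ.Realize default v ↔ φ.Realize default w) := by
  induction φ with
  | falsum => intros; rfl
  | equal s t =>
    intro k m m' v w S _ hS h0 hm hv
    have hs := realize_term_mem h0 hm hv s
    have ht := realize_term_mem h0 hm hv t
    have h1 := hS _ hs _ ht
    have h2 := hS _ ht _ hs
    have := Nat.one_le_two_pow (n := k)
    simp only [BoundedFormula.Realize, Fin.ext_iff] at *
    omega
  | rel R ts =>
    intro k m m' v w S _ hS h0 hm hv
    cases R with
    | lt =>
      have h1 := hS _ (realize_term_mem h0 hm hv (ts 1)) _ (realize_term_mem h0 hm hv (ts 0))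
      have := Nat.one_le_two_pow (n := k)
      change ((ts 0).realize (Sum.elim default v) : Fin (m + 1)) < (ts 1).realize _ ↔
        ((ts 0).realize (Sum.elim default w) : Fin (m' + 1)) < (ts 1).realize _
      simp only [Fin.lt_def] at *
      omega
  | imp φ ψ h₁ h₂ =>
    intro k m m' v w S hk hS h0 hm hv
    simp only [quantifierRank, max_le_iff] at hk
    exact imp_congr (h₁ hk.1 hS h0 hm hv) (h₂ hk.2 hS h0 hm hv)
  | @all n φ h =>
    intro k m m' v w S hk hS h0 hm hv
    obtain _ | k := k
    · simp [quantifierRank] at hk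
    simp only [quantifierRank, add_le_add_iff_right] at hk
    rw [pow_succ'] at hS
    have extend : ∀ (x : Fin (m + 1)) (y : Fin (m' + 1)),
        PreservesDist (2 ^ k) (insert ((x : ℕ), (y : ℕ)) S) →
        (φ.Realize default (Fin.snoc v x) ↔ φ.Realize default (Fin.snoc w y)) := by
      intro x y hxy
      refine h hk hxy (Finset.mem_insert_of_mem h0) (Finset.mem_insert_of_mem hm) fun i => ?_
      refine Fin.lastCases ?_ (fun i => ?_) i
      · simp
      · simpa using Or.inr (hv i)
    simp only [BoundedFormula.realize_all]
    constructor
    · intro H y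
      obtain ⟨x, hx, hxy⟩ := hS.swap.exists_insert Nat.one_le_two_pow
        (Finset.mem_image_of_mem Prod.swap h0) (Finset.mem_image_of_mem Prod.swap hm)
        (Nat.lt_succ_iff.1 y.2)
      have := hxy.swap
      rw [Finset.image_insert, Finset.image_image, Prod.swap_swap_eq, Finset.image_id] at this
      exact (extend ⟨x, by omega⟩ y this).1 (H _)
    · intro H x
      obtain ⟨y, hy, hxy⟩ := hS.exists_insert Nat.one_le_two_pow h0 hm (Nat.lt_succ_iff.1 x.2)
      exact (extend x ⟨y, by omega⟩ hxy).2 (H _)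

theorem separates_iff (φ : ordVocabulary.Sentence) (l : ℕ) :
    Separates φ (linOrdLE l) (linOrdGT l) ↔
      (∀ m, 1 ≤ m → m ≤ l → BoundedFormula.Realize (M := Fin (m + 1)) φ default default) ∧
      ∀ m, l < m → ¬ BoundedFormula.Realize (M := Fin (m + 1)) φ default default := by
  have e : ∀ m, Sentence.Realize (Fin (m + 1)) φ ↔
      BoundedFormula.Realize (M := Fin (m + 1)) φ default default := fun m => by
    rw [Sentence.Realize, Formula.Realize]
    congr! 1
  simp only [← e]
  constructor
  · rintro ⟨h₁, h₂⟩
    exact ⟨fun m h h' => h₁ _ ⟨m, h, h', rfl⟩, fun m h => h₂ _ ⟨m, h, rfl⟩⟩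
  · rintro ⟨h₁, h₂⟩
    constructor
    · rintro _ ⟨m, h, h', rfl⟩
      exact h₁ m h h'
    · rintro _ ⟨m, h, rfl⟩
      exact h₂ m h

theorem lt_two_pow_quantifierRank {φ : ordVocabulary.Sentence} {l : ℕ} (hl : 1 ≤ l)
    (h : Separates φ (linOrdLE l) (linOrdGT l)) : l < 2 ^ quantifierRank φ := by
  rw [separates_iff] at h
  by_contra! hlt
  -- The lengths `l` and `l + 1` both truncate to `2 ^ k`, with `k` the rank of `φ`.
  refine h.2 (l + 1) (by omega) ((realize_iff_of_preservesDist φ le_rfl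
    (S := {(0, 0), (l, l + 1)}) ?_ (by simp) (by simp) fun i => i.elim0).1 (h.1 l hl le_rfl))
  intro a ha b hb
  simp only [Finset.mem_insert, Finset.mem_singleton] at ha hb
  rcases ha with rfl | rfl <;> rcases hb with rfl | rfl <;> simp only <;> omega

/-! ### Number of quantifiers: prenex definability -/

/-- A property of `n`-tuples in the finite linear orders. -/
abbrev TupleProperty (n : ℕ) := ∀ m : ℕ, (Fin n → Fin (m + 1)) → Prop

/-- The property `R` is defined by a quantifier-free formula. -/
def QFDefinable {n : ℕ} (R : TupleProperty n) : Prop :=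
  ∃ φ : ordVocabulary.BoundedFormula Empty n, quantifierNumber φ = 0 ∧
    ∀ m (v : Fin n → Fin (m + 1)), φ.Realize default v ↔ R m v

/-- The property `R` is defined by a prenex formula with the given quantifier prefix, `true`
standing for `∀` and `false` for `∃`. -/
def PrenexDefinable : List Bool → ∀ {n : ℕ}, TupleProperty n → Prop
  | [], _, R => QFDefinable R
  | true :: Q, n, R => ∃ R' : TupleProperty (n + 1), PrenexDefinable Q R' ∧
      ∀ m v, R m v ↔ ∀ x, R' m (Fin.snoc v x)
  | false :: Q, n, R => ∃ R' : TupleProperty (n + 1), PrenexDefinable Q R' ∧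
      ∀ m v, R m v ↔ ∃ x, R' m (Fin.snoc v x)

theorem PrenexDefinable.exists_formula {Q : List Bool} : ∀ {n : ℕ} {R : TupleProperty n},
    PrenexDefinable Q R → ∃ φ : ordVocabulary.BoundedFormula Empty n,
      quantifierNumber φ = Q.length ∧ ∀ m (v : Fin n → Fin (m + 1)), φ.Realize default v ↔ R m v := by
  induction Q with
  | nil => exact fun h => h
  | cons b Q ih =>
    intro n R h
    cases b with
    | true =>
      obtain ⟨R', h', hR⟩ := h
      obtain ⟨φ, hφ, hR'⟩ := ih h'
      exact ⟨φ.all, by simp [quantifierNumber, hφ],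
        fun m v => by simp only [BoundedFormula.realize_all, hR, hR']⟩
    | false =>
      obtain ⟨R', h', hR⟩ := h
      obtain ⟨φ, hφ, hR'⟩ := ih h'
      exact ⟨φ.ex, by simp [quantifierNumber, hφ],
        fun m v => by simp only [BoundedFormula.realize_ex, hR, hR']⟩

theorem quantifierNumber_mapTermRel {L L' : FirstOrder.Language} {α β : Type} {g : ℕ → ℕ}
    (ft : ∀ n, L.Term (α ⊕ Fin n) → L'.Term (β ⊕ Fin (g n)))
    (fr : ∀ n, L.Relations n → L'.Relations n)
    (h : ∀ n, L'.BoundedFormula β (g (n + 1)) → L'.BoundedFormula β (g n + 1))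
    (hh : ∀ n ψ, quantifierNumber (h n ψ) = quantifierNumber ψ) {n : ℕ}
    (φ : L.BoundedFormula α n) :
    quantifierNumber (φ.mapTermRel ft fr h) = quantifierNumber φ := by
  induction φ with
  | falsum => rfl
  | equal => rfl
  | rel => rfl
  | imp φ ψ h₁ h₂ => simp [BoundedFormula.mapTermRel, quantifierNumber, h₁, h₂]
  | all φ h => simp [BoundedFormula.mapTermRel, quantifierNumber, hh, h]

theorem quantifierNumber_castLE {L : FirstOrder.Language} {α : Type} {n : ℕ}
    (φ : L.BoundedFormula α n) : ∀ {n' : ℕ} (h : n ≤ n'),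
    quantifierNumber (φ.castLE h) = quantifierNumber φ := by
  induction φ with
  | falsum => intros; rfl
  | equal => intros; rfl
  | rel => intros; rfl
  | imp φ ψ h₁ h₂ => intros; simp [BoundedFormula.castLE, quantifierNumber, h₁, h₂]
  | all φ h => intros; simp [BoundedFormula.castLE, quantifierNumber, h]

theorem QFDefinable.lift {n : ℕ} {R : TupleProperty n} (h : QFDefinable R) :
    QFDefinable (fun m (v : Fin (n + 1) → Fin (m + 1)) => R m (v ∘ Fin.castSucc)) := by
  obtain ⟨φ, hφ, hR⟩ := h
  refine ⟨φ.liftAt 1 n, ?_, fun m v => ?_⟩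
  · rw [BoundedFormula.liftAt, quantifierNumber_mapTermRel, hφ]
    exact fun _ _ => quantifierNumber_castLE _ _
  · rw [BoundedFormula.realize_liftAt_one_self, hR]

theorem QFDefinable.and {n : ℕ} {R R' : TupleProperty n} (h : QFDefinable R)
    (h' : QFDefinable R') : QFDefinable (fun m v => R m v ∧ R' m v) := by
  obtain ⟨φ, hφ, hR⟩ := h
  obtain ⟨φ', hφ', hR'⟩ := h'
  exact ⟨φ ⊓ φ', by simp [min, BoundedFormula.not, quantifierNumber, hφ, hφ'],
    fun m v => by simp only [BoundedFormula.realize_inf, hR, hR']⟩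

theorem QFDefinable.not {n : ℕ} {R : TupleProperty n} (h : QFDefinable R) :
    QFDefinable (fun m v => ¬ R m v) := by
  obtain ⟨φ, hφ, hR⟩ := h
  exact ⟨φ.not, by simp [quantifierNumber, hφ],
    fun m v => by simp only [BoundedFormula.realize_not, hR]⟩

theorem QFDefinable.const (n : ℕ) (p : Prop) : QFDefinable (n := n) (fun _ _ => p) := by
  by_cases hp : p
  · exact ⟨BoundedFormula.falsum.imp BoundedFormula.falsum, rfl,
      fun m v => by simp [hp, BoundedFormula.Realize]⟩
  · exact ⟨BoundedFormula.falsum, rfl, fun m v => by simp [hp, BoundedFormula.Realize]⟩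

/-- Terms with the variables of an `n`-tuple. -/
abbrev TupleTerm (n : ℕ) := ordVocabulary.Term (Empty ⊕ Fin n)

/-- The value of a term in the linear order of length `m`. -/
def termValue {n : ℕ} (t : TupleTerm n) (m : ℕ) (v : Fin n → Fin (m + 1)) : ℕ :=
  (t.realize (Sum.elim default v) : Fin (m + 1)).val

theorem termValue_le {n : ℕ} (t : TupleTerm n) (m : ℕ) (v : Fin n → Fin (m + 1)) :
    termValue t m v ≤ m := Nat.lt_succ_iff.1 (Fin.isLt _)

@[simp]
theorem termValue_lift {n : ℕ} (t : TupleTerm n) (m : ℕ) (v : Fin n → Fin (m + 1))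
    (x : Fin (m + 1)) :
    termValue (t.relabel (Sum.map id Fin.castSucc)) m (Fin.snoc v x) = termValue t m v := by
  rw [termValue, termValue, Term.realize_relabel]
  congr 2
  ext i
  rcases i with i | i
  · exact i.elim
  · simp

@[simp]
theorem termValue_last {n : ℕ} (m : ℕ) (v : Fin n → Fin (m + 1)) (x : Fin (m + 1)) :
    termValue (Term.var (Sum.inr (Fin.last n))) m (Fin.snoc v x) = x := by
  simp [termValue]

theorem QFDefinable.lt {n : ℕ} (s t : TupleTerm n) :
    QFDefinable (fun m v => termValue s m v < termValue t m v) :=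
  ⟨BoundedFormula.rel (l := 2) (OrdRelations.lt : ordVocabulary.Relations 2) ![s, t], rfl,
    fun _ _ => Iff.rfl⟩

theorem QFDefinable.le {n : ℕ} (s t : TupleTerm n) :
    QFDefinable (fun m v => termValue s m v ≤ termValue t m v) := by
  simpa using (QFDefinable.lt t s).not

theorem PrenexDefinable.const (Q : List Bool) (p : Prop) : ∀ n : ℕ,
    PrenexDefinable Q (n := n) (fun _ _ => p) := by
  induction Q with
  | nil => exact fun n => QFDefinable.const n p
  | cons b Q ih =>
    intro n
    cases b <;> exact ⟨_, ih _, by simp⟩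

/-- A quantifier-free condition does not involve the bound variable, so both branches can share each
quantifier. -/
theorem PrenexDefinable.ite {Q : List Bool} : ∀ {n : ℕ} {C R R' : TupleProperty n},
    QFDefinable C → PrenexDefinable Q R → PrenexDefinable Q R' →
    PrenexDefinable Q (fun m v => (C m v ∧ R m v) ∨ (¬ C m v ∧ R' m v)) := by
  induction Q with
  | nil =>
    intro n C R R' hC h h'
    have := ((hC.and h).not.and (hC.not.and h').not).not
    have e : (fun m v => (C m v ∧ R m v) ∨ (¬ C m v ∧ R' m v)) =
        (fun m v => ¬ (¬ (C m v ∧ R m v) ∧ ¬ (¬ C m v ∧ R' m v))) := by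
      ext m v
      tauto
    rw [e]
    exact this
  | cons b Q ih =>
    intro n C R R' hC h h'
    have hs : ∀ m (v : Fin n → Fin (m + 1)) (x : Fin (m + 1)),
        (Fin.snoc v x : Fin (n + 1) → Fin (m + 1)) ∘ Fin.castSucc = v := by
      intro m v x
      ext i
      simp
    cases b <;>
    · obtain ⟨S, hS, hR⟩ := h
      obtain ⟨S', hS', hR'⟩ := h'
      refine ⟨_, ih hC.lift hS hS', fun m v => ?_⟩
      simp only [hs, hR, hR']
      by_cases hc : C m v <;> simp [hc]

/-! ### Distances -/

/-- Prenex formulas with prefix `Q` define, for `s ≤ z ≤ t` and `A, B ≤ c`, that the distance from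
`s` to `z` is less than `A` and that from `z` to `t` is less than `B`. -/
def DefinesAnd (Q : List Bool) (c : ℕ) : Prop :=
  ∀ (n : ℕ) (s z t : TupleTerm n) (A B : ℕ), A ≤ c → B ≤ c →
    ∃ R : TupleProperty n, PrenexDefinable Q R ∧
      ∀ m v, termValue s m v ≤ termValue z m v → termValue z m v ≤ termValue t m v →
        (R m v ↔ termValue z m v < termValue s m v + A ∧ termValue t m v < termValue z m v + B)

/-- Prenex formulas with prefix `Q` define, for `s ≤ z ≤ t` and `A, B ≤ c`, that the distance from
`s` to `z` is less than `A` or that from `z` to `t` is less than `B`. -/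
def DefinesOr (Q : List Bool) (c : ℕ) : Prop :=
  ∀ (n : ℕ) (s z t : TupleTerm n) (A B : ℕ), A ≤ c → B ≤ c →
    ∃ R : TupleProperty n, PrenexDefinable Q R ∧
      ∀ m v, termValue s m v ≤ termValue z m v → termValue z m v ≤ termValue t m v →
        (R m v ↔ termValue z m v < termValue s m v + A ∨ termValue t m v < termValue z m v + B)

theorem definesOr_nil : DefinesOr [] 1 := by
  intro n s z t A B hA hB
  refine ⟨_, (((QFDefinable.const n (1 ≤ A)).and (QFDefinable.le z s)).not.and
    ((QFDefinable.const n (1 ≤ B)).and (QFDefinable.le t z)).not).not, fun m v h₁ h₂ => ?_⟩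
  omega

/-- A distance is less than `A` iff every intermediate point is within less than `A / 2` of the left
end or less than `(A + 1) / 2` of the right end. -/
theorem DefinesOr.definesAnd_cons {Q : List Bool} {c : ℕ} (h : DefinesOr Q c) :
    DefinesAnd (true :: Q) (2 * c) := by
  intro n s z t A B hA hB
  set s' : TupleTerm (n + 1) := s.relabel (Sum.map id Fin.castSucc) with hs
  set z' : TupleTerm (n + 1) := z.relabel (Sum.map id Fin.castSucc) with hz
  set t' : TupleTerm (n + 1) := t.relabel (Sum.map id Fin.castSucc) with ht
  set w : TupleTerm (n + 1) := Term.var (Sum.inr (Fin.last n)) with hw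
  obtain ⟨R₁, hR₁, h₁⟩ := h (n + 1) s' w z' (A / 2) ((A + 1) / 2) (by omega) (by omega)
  -- The point `w = z` is tested in the left interval. The larger half next to `z` keeps the
  -- counterexample `z + (B + 1) / 2` strictly beyond `z` when `B ≥ 1`; `B = 0` is treated apart.
  obtain ⟨R₂, hR₂, h₂⟩ := h (n + 1) z' w t' ((B + 1) / 2) (B / 2) (by omega) (by omega)
  refine ⟨_, ⟨_, PrenexDefinable.ite (QFDefinable.const _ (B = 0)) (PrenexDefinable.const Q False _)
    (PrenexDefinable.ite (QFDefinable.le w z')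
      (PrenexDefinable.ite (QFDefinable.le s' w) hR₁ (PrenexDefinable.const Q True _))
      (PrenexDefinable.ite (QFDefinable.le w t') hR₂ (PrenexDefinable.const Q True _))),
    fun m v => Iff.rfl⟩, fun m v hsz hzt => ?_⟩
  have e₁ := fun x => h₁ m (Fin.snoc v x)
  have e₂ := fun x => h₂ m (Fin.snoc v x)
  have htm := termValue_le t m v
  simp only [hs, hz, ht, hw, termValue_lift, termValue_last] at e₁ e₂ ⊢
  constructor
  · intro H
    constructor
    · by_contra hlt
      have := H ⟨termValue s m v + A / 2, by omega⟩
      have := e₁ ⟨termValue s m v + A / 2, by omega⟩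
      simp only at *
      grind
    · by_contra hlt
      have := H ⟨termValue z m v + (B + 1) / 2, by omega⟩
      have := e₂ ⟨termValue z m v + (B + 1) / 2, by omega⟩
      simp only at *
      grind
  · rintro ⟨H₁, H₂⟩ x
    have := e₁ x
    have := e₂ x
    grind

/-- A distance is less than `A`, that is at most `A - 1`, iff some intermediate point splits it into
parts less than `(A + 1) / 2` and `(A + 2) / 2`. These sum to `A + 1`, whence the loss of one in `2
* c - 1`. -/
theorem DefinesAnd.definesOr_cons {Q : List Bool} {c : ℕ} (h : DefinesAnd Q c) :
    DefinesOr (false :: Q) (2 * c - 1) := by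
  intro n s z t A B hA hB
  obtain rfl | hc := Nat.eq_zero_or_pos c
  · obtain rfl : A = 0 := by omega
    obtain rfl : B = 0 := by omega
    exact ⟨_, PrenexDefinable.const _ False n, fun m v _ _ => ⟨False.elim, fun _ => by omega⟩⟩
  set s' : TupleTerm (n + 1) := s.relabel (Sum.map id Fin.castSucc) with hs
  set z' : TupleTerm (n + 1) := z.relabel (Sum.map id Fin.castSucc) with hz
  set t' : TupleTerm (n + 1) := t.relabel (Sum.map id Fin.castSucc) with ht
  set w : TupleTerm (n + 1) := Term.var (Sum.inr (Fin.last n)) with hw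
  obtain ⟨R₁, hR₁, h₁⟩ := h (n + 1) s' w z' ((A + 1) / 2) ((A + 2) / 2) (by omega) (by omega)
  obtain ⟨R₂, hR₂, h₂⟩ := h (n + 1) z' w t' ((B + 2) / 2) ((B + 1) / 2) (by omega) (by omega)
  -- If `z = t`, no point lies strictly beyond `z` to witness the right disjunct, so this case is
  -- settled without a witness.
  refine ⟨_, ⟨_, PrenexDefinable.ite ((QFDefinable.const _ (1 ≤ B)).and (QFDefinable.le t' z'))
    (PrenexDefinable.const Q True _)
    (PrenexDefinable.ite (QFDefinable.le w z')
      (PrenexDefinable.ite (QFDefinable.le s' w) hR₁ (PrenexDefinable.const Q False _))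
      (PrenexDefinable.ite (QFDefinable.le w t') hR₂ (PrenexDefinable.const Q False _))),
    fun m v => Iff.rfl⟩, fun m v hsz hzt => ?_⟩
  have e₁ := fun x => h₁ m (Fin.snoc v x)
  have e₂ := fun x => h₂ m (Fin.snoc v x)
  have htm := termValue_le t m v
  simp only [hs, hz, ht, hw, termValue_lift, termValue_last] at e₁ e₂ ⊢
  constructor
  · rintro ⟨x, H⟩
    have := e₁ x
    have := e₂ x
    grind
  · by_cases hd : 1 ≤ B ∧ termValue t m v ≤ termValue z m v
    · exact fun _ => ⟨0, Or.inl ⟨hd, trivial⟩⟩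
    rintro (H | H)
    · have hx : termValue s m v + min (termValue z m v - termValue s m v) ((A + 1) / 2 - 1)
        < m + 1 := by omega
      refine ⟨⟨_, hx⟩, Or.inr ⟨hd, Or.inl ⟨?_, Or.inl ⟨?_, (e₁ _ ?_ ?_).2 ⟨?_, ?_⟩⟩⟩⟩⟩ <;>
        simp only <;> omega
    · have hx : termValue z m v + min (termValue t m v - termValue z m v) ((B + 2) / 2 - 1)
        < m + 1 := by omega
      refine ⟨⟨_, hx⟩, Or.inr ⟨hd, Or.inr ⟨?_, Or.inl ⟨?_, (e₂ _ ?_ ?_).2 ⟨?_, ?_⟩⟩⟩⟩⟩ <;>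
        simp only <;> omega

theorem DefinesAnd.mono {Q : List Bool} {c c' : ℕ} (h : DefinesAnd Q c) (hc : c' ≤ c) :
    DefinesAnd Q c' :=
  fun n s z t A B hA hB => h n s z t A B (hA.trans hc) (hB.trans hc)

theorem exists_definesAnd (j : ℕ) :
    ∃ Q : List Bool, Q.length = 2 * j + 1 ∧ DefinesAnd Q (2 ^ (2 * j) + 1) := by
  induction j with
  | zero => exact ⟨_, rfl, definesOr_nil.definesAnd_cons⟩
  | succ j ih =>
    obtain ⟨Q, hQ, h⟩ := ih
    -- Two quantifiers turn `c` into `2 * (2 * c - 1) = 4 * c - 2`, so `2 ^ (2 * j) + 1` suffices as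
    -- invariant.
    refine ⟨true :: false :: Q, by simp [hQ]; ring, h.definesOr_cons.definesAnd_cons.mono ?_⟩
    rw [mul_add, pow_add]
    omega

theorem exists_sentence_of_lt_two_pow {l k : ℕ} (h : l < 2 ^ k) :
    ∃ φ : ordVocabulary.Sentence,
      Separates φ (linOrdLE l) (linOrdGT l) ∧ quantifierNumber φ = k + 1 := by
  let a : TupleTerm 0 := Constants.term (OrdFunctions.min : ordVocabulary.Functions 0)
  let b : TupleTerm 0 := Constants.term (OrdFunctions.max : ordVocabulary.Functions 0)
  have ha : ∀ m v, termValue a m v = 0 := fun m v => rfl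
  have hb : ∀ m v, termValue b m v = m := fun m v => rfl
  suffices H : ∃ Q : List Bool, Q.length = k + 1 ∧ ∃ R : TupleProperty 0, PrenexDefinable Q R ∧
      ∀ m v, R m v ↔ m < l + 1 by
    obtain ⟨Q, hQ, R, hR, hRl⟩ := H
    obtain ⟨φ, hφ, hφR⟩ := hR.exists_formula
    refine ⟨φ, (separates_iff φ l).2 ⟨fun m _ hm => ?_, fun m hm => ?_⟩, by omega⟩
    · exact (hφR _ _).2 ((hRl _ _).2 (by omega))
    · rw [hφR, hRl]
      omega
  obtain ⟨j, rfl | rfl⟩ := k.even_or_odd'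
  · obtain ⟨Q, hQ, hd⟩ := exists_definesAnd j
    -- With `z = t = max`, the bound `B = 1` makes the second conjunct true.
    obtain ⟨R, hR, e⟩ := hd 0 a b b (l + 1) 1 (by omega) (by omega)
    refine ⟨Q, hQ, R, hR, fun m v => ?_⟩
    have := e m v
    simp only [ha, hb] at this
    rw [this (by omega) (by omega)]
    omega
  · obtain ⟨Q, hQ, hd⟩ := exists_definesAnd j
    rw [pow_succ] at h
    -- Here `B = 0` makes the second disjunct false.
    obtain ⟨R, hR, e⟩ := hd.definesOr_cons 0 a b b (l + 1) 0 (by omega) (by omega)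
    refine ⟨false :: Q, by simp [hQ], R, hR, fun m v => ?_⟩
    have := e m v
    simp only [ha, hb] at this
    rw [this (by omega) (by omega)]
    omega

end LinearOrderSeparation

open LinearOrderSeparation in
theorem mainTheorem5 (l : ℕ) (hl : 1 ≤ l) :
    (∃ φ : ordVocabulary.Sentence, Separates φ (linOrdLE l) (linOrdGT l)) ∧
      minRank l ≤ minNumber l ∧ minNumber l ≤ minRank l + 1 := by
  obtain ⟨φ₀, h₀, -⟩ := exists_sentence_of_lt_two_pow l.lt_two_pow_self
  refine ⟨⟨φ₀, h₀⟩, ?_, ?_⟩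
  · obtain ⟨φ, h, e⟩ : minNumber l ∈ {k | ∃ φ : ordVocabulary.Sentence,
      Separates φ (linOrdLE l) (linOrdGT l) ∧ quantifierNumber φ = k} :=
        Nat.sInf_mem ⟨_, φ₀, h₀, rfl⟩
    have hr : minRank l ≤ quantifierRank φ := Nat.sInf_le ⟨φ, h, rfl⟩
    rw [← e]
    exact hr.trans (quantifierRank_le_quantifierNumber φ)
  · obtain ⟨φ, h, e⟩ : minRank l ∈ {k | ∃ φ : ordVocabulary.Sentence,
      Separates φ (linOrdLE l) (linOrdGT l) ∧ quantifierRank φ = k} :=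
        Nat.sInf_mem ⟨_, φ₀, h₀, rfl⟩
    have hlt := lt_two_pow_quantifierRank hl h
    rw [e] at hlt
    exact Nat.sInf_le (exists_sentence_of_lt_two_pow hlt)
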